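/- Let $k$ be an arbitrary field and let $n\ge 3$. Let $\mathcal A=\{d_1,\dots,d_n\}$ be a generalized arithmetic sequence of positive integers, i.e. there is an integer $h\ge 1$ such that $h d_1,d_2,\dots,d_n$ is an arithmetic sequence with positive common difference. Assume that $\gcd(d_1,\dots,d_n)=1$ and that $\mathcal A$ is a minimal generating set of the numerical semigroup $\mathcal S=\mathbb N d_1+\dots+\mathbb N d_n$. Let $I_{\mathcal A}$ be the toric ideal of the affine monomial curve defined by $\mathcal A$, i.e. the kernel of the homomorphism of $k$-algebras $k[x_1,\dots,x_n]\to k[t]$, $x_i\mapsto t^{d_i}$. Call an ideal a complete intersection if its minimal number of generators equals its height. Then $I_{\mathcal A}$ is a complete intersection if and only if $n=3$ and $d_1$ is even. Moreover, if $I_{\mathcal A}$ is a complete intersection (so $n=3$ and $d_1$ is even), then $d_3$ is even; the integer $h\ge 1$ such that $h d_1,d_2,d_3$ is an arithmetic sequence is $h=(2d_2-d_3)/d_1$; the two binomials $$x_2^2-x_1^{h}x_3,\qquad x_1^{d_3/2}-x_3^{d_1/2}$$ form a minimal set of generators of $I_{\mathcal A}$; and the Frobenius number of $\mathcal S$, i.e.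 the largest integer not belonging to $\mathcal S$, is $$g(\mathcal S)=\frac{d_1d_3}{2}-d_1+d_2-d_3 .$$ -/

import Mathlib

/-- A finite sequence of natural numbers is an increasing arithmetic sequence: consecutive terms
differ by a constant positive amount. -/
def IsIncreasingArithmeticSeq {n : ℕ} (s : Fin n → ℕ) : Prop :=
  ∃ D : ℕ, 0 < D ∧ ∀ i j : Fin n, (j : ℕ) = (i : ℕ) + 1 → s j = s i + D

/-- The sequence `h d₁, d₂, …, dₙ` is an increasing arithmetic sequence, where `h ≥ 1`.
The term `d₁` is the value of `d` at the index `0`. -/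
def IsGenArithmeticSeqWith {n : ℕ} (h : ℕ) (d : Fin n → ℕ) : Prop :=
  0 < h ∧ IsIncreasingArithmeticSeq (fun i => if (i : ℕ) = 0 then h * d i else d i)

/-- Generalized arithmetic sequences of positive integers. -/
def IsGenArithmeticSeq {n : ℕ} (d : Fin n → ℕ) : Prop :=
  (∀ i, 0 < d i) ∧ ∃ h : ℕ, IsGenArithmeticSeqWith h d

/-- The set `{d₁, …, dₙ}` is a minimal generating set (with respect to inclusion) of the
semigroup `ℕ d₁ + ⋯ + ℕ dₙ`. -/
def MinimallyGeneratesSemigroup {n : ℕ} (d : Fin n → ℕ) : Prop :=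
  Minimal (fun B : Set ℕ => AddSubmonoid.closure B = AddSubmonoid.closure (Set.range d))
    (Set.range d)

/-- The toric ideal of the affine monomial curve `t ↦ (t ^ d₁, …, t ^ dₙ)`: the kernel of the
`k`-algebra homomorphism `k[x₁, …, xₙ] → k[t]`, `xᵢ ↦ t ^ dᵢ`. -/
noncomputable def toricIdeal (k : Type*) [Field k] {n : ℕ} (d : Fin n → ℕ) :
    Ideal (MvPolynomial (Fin n) k) :=
  RingHom.ker
    (MvPolynomial.aeval (fun i => (Polynomial.X : Polynomial k) ^ d i) :
      MvPolynomial (Fin n) k →ₐ[k] Polynomial k)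

/-- A finitely generated ideal is a complete intersection if its minimal number of generators
equals its height. -/
def IsCompleteIntersectionIdeal {R : Type*} [CommRing R] (I : Ideal R) : Prop :=
  I.FG ∧ (Submodule.spanFinrank I : ℕ∞) = I.height

open MvPolynomial

/-! Indices start at 0, as in the code. The toric ideal `I` lies strictly inside the maximal ideal
at the origin, so its height is less than `n`. It therefore fails to be a complete intersection once
it needs `n` generators. Generators are counted modulo `𝔪 I`: if no proper divisor of a monomial
occurs in `I`, its coefficient is a linear form on `I / 𝔪 I`. Enough binomials with such leading
monomials exist when `n ≥ 4` (`le_spanFinrank_of_four_le`) and when `n = 3` with `d 0` odd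
(`three_le_spanFinrank_of_odd`). If `n = 3` and `d 0 = 2a`, then `d 2 = 2b` with `a`, `b` coprime,
and `d 1` is odd with `2 d 1 = h d 0 + d 2`. So `S` is glued from `2⟨a, b⟩` and `d 1`. The gluing
relation and the relation of `⟨a, b⟩` generate `I` (`toricIdeal_eq_span`), a chain of primes gives
height 2, and the Frobenius number comes from Sylvester's formula for `⟨a, b⟩`. -/

theorem eq_zero_of_weight_eq_zero {σ : Type*} {d : σ → ℕ} (hd : ∀ i, 0 < d i) {v : σ →₀ ℕ}
    (hv : Finsupp.weight d v = 0) : v = 0 := by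
  ext i
  simpa [hv] using Finsupp.le_weight d (hd i).ne' v

theorem aeval_X_pow_monomial {k σ : Type*} [Field k] (d : σ → ℕ) (u : σ →₀ ℕ) (r : k) :
    (aeval (fun i => (Polynomial.X : Polynomial k) ^ d i) : MvPolynomial σ k →ₐ[k] Polynomial k)
      (monomial u r) = Polynomial.monomial (Finsupp.weight d u) r := by
  rw [aeval_monomial, ← Polynomial.C_mul_X_pow_eq_monomial, Finsupp.weight_apply, Finsupp.prod,
    Finsupp.sum, ← Finset.prod_pow_eq_pow_sum]
  simp only [← pow_mul, smul_eq_mul, mul_comm]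
  rfl

theorem coeff_aeval_X_pow {k σ : Type*} [Field k] (d : σ → ℕ) (f : MvPolynomial σ k) (s : ℕ) :
    ((aeval (fun i => (Polynomial.X : Polynomial k) ^ d i) :
      MvPolynomial σ k →ₐ[k] Polynomial k) f).coeff s =
      ∑ u ∈ f.support, if Finsupp.weight d u = s then coeff u f else 0 := by
  conv_lhs => rw [f.as_sum]
  simp only [map_sum, aeval_X_pow_monomial, Polynomial.finsetSum_coeff, Polynomial.coeff_monomial]

/-! ### Toric ideals: binomials, lower bound on generators, height -/

section ToricIdeal

variable {k : Type*} [Field k] {n : ℕ} {d : Fin n → ℕ}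

theorem monomial_sub_monomial_mem_toricIdeal {u v : Fin n →₀ ℕ}
    (h : Finsupp.weight d u = Finsupp.weight d v) :
    monomial u (1 : k) - monomial v 1 ∈ toricIdeal k d := by
  rw [toricIdeal, RingHom.mem_ker, map_sub]
  erw [aeval_X_pow_monomial, aeval_X_pow_monomial]
  rw [h, sub_self]

/-- A monomial that is alone in its degree does not occur in the toric ideal. -/
theorem coeff_eq_zero_of_mem_toricIdeal {f : MvPolynomial (Fin n) k} (hf : f ∈ toricIdeal k d)
    {u : Fin n →₀ ℕ} (hu : ∀ v, Finsupp.weight d v = Finsupp.weight d u → v = u) :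
    coeff u f = 0 := by
  rw [toricIdeal, RingHom.mem_ker] at hf
  have h := (coeff_aeval_X_pow d f (Finsupp.weight d u)).symm.trans
    (congrArg (Polynomial.coeff · (Finsupp.weight d u)) hf)
  rw [Finset.sum_eq_single u] at h
  · simpa using h
  · intro v _ hv
    exact if_neg fun h => hv (hu v h)
  · intro hu
    simpa using hu

/-- An ideal containing all binomials of equal weight contains the toric ideal. -/
theorem toricIdeal_le {J : Ideal (MvPolynomial (Fin n) k)}
    (hJ : ∀ u v, Finsupp.weight d u = Finsupp.weight d v →
      monomial u (1 : k) - monomial v 1 ∈ J) : toricIdeal k d ≤ J := by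
  classical
  -- `V` picks one monomial in each attained weight. Modulo `J` every polynomial then depends only
  -- on its image in `k[t]`, so the kernel falls into `J`.
  let V : ℕ → (Fin n →₀ ℕ) := fun s =>
    if h : ∃ u, Finsupp.weight d u = s then h.choose else 0
  have hV : ∀ u : Fin n →₀ ℕ, Finsupp.weight d (V (Finsupp.weight d u)) = Finsupp.weight d u := by
    intro u
    have h : ∃ v, Finsupp.weight d v = Finsupp.weight d u := ⟨u, rfl⟩
    simp only [V, dif_pos h]
    exact h.choose_spec
  let L : Polynomial k →ₗ[k] MvPolynomial (Fin n) k :=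
    Polynomial.lsum fun s => (monomial (V s) : k →ₗ[k] MvPolynomial (Fin n) k)
  intro p hp
  rw [toricIdeal, RingHom.mem_ker] at hp
  have key : ∀ q : MvPolynomial (Fin n) k,
      q - L ((aeval (fun i => (Polynomial.X : Polynomial k) ^ d i) :
        MvPolynomial (Fin n) k →ₐ[k] Polynomial k) q) ∈ J := by
    intro q
    induction q using MvPolynomial.induction_on' with
    | monomial u a =>
      rw [aeval_X_pow_monomial]
      have hL : L (Polynomial.monomial (Finsupp.weight d u) a) =
          monomial (V (Finsupp.weight d u)) a := by
        simp [L, Polynomial.lsum_apply, Polynomial.sum_monomial_index]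
      rw [hL]
      have := J.mul_mem_left (C a) (hJ u _ (hV u).symm)
      rwa [mul_sub, C_mul_monomial, C_mul_monomial, mul_one] at this
    | add p q hp hq =>
      rw [map_add, map_add, add_sub_add_comm]
      exact J.add_mem hp hq
  have := key p
  erw [hp] at this
  simpa using this

theorem coeff_mul_of_forall_lt {σ : Type*} {m : σ →₀ ℕ} {f : MvPolynomial σ k}
    (hf : ∀ u < m, coeff u f = 0) (p : MvPolynomial σ k) :
    coeff m (p * f) = coeff 0 p * coeff m f := by
  classical
  rw [coeff_mul, Finset.sum_eq_single (0, m)]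
  · rintro ⟨a, b⟩ hab hne
    replace hab : a + b = m := by simpa using hab
    rw [show coeff (a, b).2 f = 0 from hf b ?_, mul_zero]
    refine lt_of_le_of_ne (hab ▸ le_add_self) ?_
    rintro rfl
    exact hne (by simpa using hab)
  · simp

/-- A graded form of Nakayama's lemma: coefficients at monomials all of whose proper divisors do
not occur in `I` are linear forms on `I` that vanish on `𝔪 I`. -/
theorem card_le_spanFinrank_of_linearIndependent {σ ι : Type*} [Fintype ι]
    {I : Ideal (MvPolynomial σ k)} (hI : I.FG) (m : ι → σ →₀ ℕ)
    (hm : ∀ i, ∀ u < m i, ∀ f ∈ I, coeff u f = 0) (g : ι → MvPolynomial σ k)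
    (hg : ∀ j, g j ∈ I) (hlin : LinearIndependent k fun j i => coeff (m i) (g j)) :
    Fintype.card ι ≤ Submodule.spanFinrank I := by
  classical
  obtain ⟨G, hG, hspan⟩ := Submodule.FG.exists_span_finset_card_eq_spanFinrank hI
  let Φ : MvPolynomial σ k →ₗ[k] (ι → k) := LinearMap.pi fun i => lcoeff k (m i)
  have hΦ : ∀ f i, Φ f i = coeff (m i) f := fun f i => rfl
  -- Only the constant term of a multiplier is seen by `Φ`, so the images of ideal generators
  -- already span `Φ(I)` over `k`.
  have key : ∀ f ∈ I, Φ f ∈ Submodule.span k (G.image Φ : Set (ι → k)) := by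
    intro f hf
    rw [← hspan] at hf
    induction hf using Submodule.span_induction with
    | mem x hx => exact Submodule.subset_span (by simpa using ⟨x, hx, rfl⟩)
    | zero => simp
    | add x y _ _ hx hy => rw [map_add]; exact Submodule.add_mem _ hx hy
    | smul p x hx h =>
      have : Φ (p • x) = coeff 0 p • Φ x := by
        ext i
        rw [hspan] at hx
        rw [Pi.smul_apply, hΦ, hΦ, smul_eq_mul, smul_eq_mul,
          coeff_mul_of_forall_lt fun u hu => hm i u hu x hx]
      rw [this]
      exact Submodule.smul_mem _ _ h
  have h := linearIndependent_le_span' _ hlin (G.image Φ : Set (ι → k)) (by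
    rintro _ ⟨j, rfl⟩
    exact key _ (hg j))
  rw [Cardinal.mk_fintype, Nat.cast_le] at h
  refine h.trans ?_
  rw [← hG]
  simpa using Finset.card_image_le

theorem toricIdeal_fg : (toricIdeal k d).FG := IsNoetherian.noetherian _

/-- A lower bound for the number of generators of the toric ideal by a family of binomials
`x ^ m i - x ^ w i` whose first monomials have all their proper divisors alone in their degree. -/
theorem card_le_spanFinrank_toricIdeal {ι : Type*} [Fintype ι] (m w : ι → Fin n →₀ ℕ)
    (hm : Function.Injective m)
    (hmw : ∀ i, Finsupp.weight d (m i) = Finsupp.weight d (w i))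
    (hmin : ∀ i, ∀ u < m i, ∀ v, Finsupp.weight d v = Finsupp.weight d u → v = u)
    (r : ι → ℕ) (hr : ∀ i j, r i ≤ r j → w j ≠ m i) :
    Fintype.card ι ≤ Submodule.spanFinrank (toricIdeal k d) := by
  classical
  refine card_le_spanFinrank_of_linearIndependent toricIdeal_fg m
    (fun i u hu f hf => coeff_eq_zero_of_mem_toricIdeal hf (hmin i u hu))
    (fun j => monomial (m j) 1 - monomial (w j) 1)
    (fun j => monomial_sub_monomial_mem_toricIdeal (hmw j)) ?_
  rw [Fintype.linearIndependent_iff]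
  intro c hc
  -- Ordered by `r`, the coefficient matrix is triangular with 1 on the diagonal.
  have main : ∀ s i, r i = s → c i = 0 := by
    intro s
    induction s using Nat.strong_induction_on with
    | _ s ih =>
      rintro i rfl
      have h := congrFun hc i
      rw [Finset.sum_apply, Finset.sum_eq_single i] at h
      · simpa [coeff_monomial, hr i i le_rfl] using h
      · intro j _ hj
        rcases lt_or_ge (r j) (r i) with hlt | hle
        · simp [ih _ hlt j rfl]
        · simp [coeff_monomial, hr i j hle, hm.ne hj]
      · simp
  exact fun i => main _ i rfl

instance toricIdeal_isPrime : (toricIdeal k d).IsPrime := by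
  unfold toricIdeal
  exact RingHom.ker_isPrime _

/-- The toric ideal of a monomial curve has height less than the number of variables. -/
theorem height_toricIdeal_lt (hn : 0 < n) (hd : ∀ i, 0 < d i) : (toricIdeal k d).height < n := by
  classical
  let M : Ideal (MvPolynomial (Fin n) k) :=
    RingHom.ker (constantCoeff : MvPolynomial (Fin n) k →+* k)
  have hM : M.IsPrime := RingHom.ker_isPrime _
  have hlt : toricIdeal k d < M := by
    refine lt_of_le_of_ne ?_ ?_
    · intro f hf
      rw [RingHom.mem_ker, constantCoeff_eq]
      refine coeff_eq_zero_of_mem_toricIdeal hf fun v hv => ?_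
      rw [map_zero] at hv
      exact eq_zero_of_weight_eq_zero hd hv
    · intro h
      have hX : (X ⟨0, hn⟩ : MvPolynomial (Fin n) k) ∈ M := by
        simp [M, RingHom.mem_ker]
      rw [← h, toricIdeal, RingHom.mem_ker] at hX
      simp at hX
  have hMh : M.height ≤ n := by
    have h := Ideal.height_le_ringKrullDim_of_isPrime (I := M)
    rw [MvPolynomial.ringKrullDim_of_isNoetherianRing, ringKrullDim_eq_zero_of_field, zero_add,
      Nat.card_fin] at h
    exact_mod_cast h
  exact (Ideal.height_strict_mono_of_isPrime_of_isPrime hlt).trans_le hMh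

end ToricIdeal

/-! ### Factorizations in a minimally generated semigroup -/

theorem mem_closure_range_iff_exists_weight {n : ℕ} {d : Fin n → ℕ} {s : ℕ} :
    s ∈ AddSubmonoid.closure (Set.range d) ↔ ∃ u : Fin n →₀ ℕ, Finsupp.weight d u = s := by
  rw [AddSubmonoid.mem_closure_range_iff]
  simp only [Finsupp.weight_apply, eq_comm]

section Semigroup

variable {n : ℕ} {d : Fin n → ℕ}

/-- A factorization avoiding `i` would make the generator `d i` redundant; one using `i` has weight
0 left over. -/
theorem MinimallyGeneratesSemigroup.eq_single (hmin : MinimallyGeneratesSemigroup d)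
    (hd : ∀ i, 0 < d i) (hinj : Function.Injective d) {u : Fin n →₀ ℕ} {i : Fin n}
    (hu : Finsupp.weight d u = d i) : u = Finsupp.single i 1 := by
  have hsplit := Finsupp.single_add_erase i u
  have hw := congrArg (Finsupp.weight d) hsplit
  rw [map_add, Finsupp.weight_single, hu, smul_eq_mul] at hw
  rcases Nat.eq_zero_or_pos (u i) with h0 | hpos
  · exfalso
    have hmem : Finsupp.weight d u ∈ AddSubmonoid.closure (Set.range d \ {d i}) := by
      rw [Finsupp.weight_apply]
      refine AddSubmonoid.sum_mem _ fun j hj => AddSubmonoid.nsmul_mem _ ?_ _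
      refine AddSubmonoid.subset_closure ⟨⟨j, rfl⟩, fun h => ?_⟩
      rw [hinj h, Finsupp.mem_support_iff] at hj
      exact hj h0
    rw [hu] at hmem
    have hclo : AddSubmonoid.closure (Set.range d \ {d i}) =
        AddSubmonoid.closure (Set.range d) := by
      refine le_antisymm (AddSubmonoid.closure_mono Set.sdiff_subset) ?_
      rw [AddSubmonoid.closure_le]
      intro x hx
      by_cases hxi : x = d i
      · exact hxi ▸ hmem
      · exact AddSubmonoid.subset_closure ⟨hx, hxi⟩
    exact (hmin.2 hclo Set.sdiff_subset ⟨i, rfl⟩).2 rfl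
  · have h1 : u i = 1 := by
      have : u i * d i ≤ 1 * d i := by omega
      have := Nat.le_of_mul_le_mul_right this (hd i)
      omega
    rw [h1, one_mul] at hw
    have := eq_zero_of_weight_eq_zero hd (v := u.erase i) (by omega)
    rw [← hsplit, this, h1, add_zero]

/-- A proper divisor of a quadratic monomial is 1 or a variable. This makes quadratic monomials
admissible in `card_le_spanFinrank_toricIdeal`. -/
theorem MinimallyGeneratesSemigroup.eq_of_lt_single_add_single
    (hmin : MinimallyGeneratesSemigroup d) (hd : ∀ i, 0 < d i) (hinj : Function.Injective d)
    {i j : Fin n} {u v : Fin n →₀ ℕ} (hu : u < Finsupp.single i 1 + Finsupp.single j 1)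
    (hv : Finsupp.weight d v = Finsupp.weight d u) : v = u := by
  obtain ⟨c, hc⟩ := exists_add_of_le hu.le
  have hc0 : c ≠ 0 := by
    rintro rfl
    exact hu.ne (by simpa using hc.symm)
  have hdeg := congrArg Finsupp.degree hc
  rw [map_add, map_add, Finsupp.degree_single, Finsupp.degree_single] at hdeg
  have hcd : c.degree ≠ 0 := fun h => hc0 ((Finsupp.degree_eq_zero_iff c).1 h)
  rcases Nat.eq_zero_or_pos u.degree with h0 | hpos
  · rw [(Finsupp.degree_eq_zero_iff u).1 h0, map_zero] at hv
    rw [(Finsupp.degree_eq_zero_iff u).1 h0, eq_zero_of_weight_eq_zero hd hv]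
  · have h1 : u ∈ {w : Fin n →₀ ℕ | w.degree = 1} := by
      change u.degree = 1
      omega
    rw [← Finsupp.range_single_one] at h1
    obtain ⟨l, rfl⟩ := h1
    refine hmin.eq_single hd hinj (hv.trans ?_)
    simp [Finsupp.weight_single]

/-- The least positive multiple of `d i` lying in the semigroup generated by the other terms. -/
theorem exists_critical_multiple (hd : ∀ i, 0 < d i) {i j : Fin n} (hij : j ≠ i) :
    ∃ c : ℕ, 0 < c ∧ (∃ w : Fin n →₀ ℕ, w i = 0 ∧ Finsupp.weight d w = c * d i) ∧
      (∀ a, 0 < a → (∃ w : Fin n →₀ ℕ, w i = 0 ∧ Finsupp.weight d w = a * d i) → c ≤ a) ∧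
      ∀ u < Finsupp.single i c, ∀ v, Finsupp.weight d v = Finsupp.weight d u → v = u := by
  classical
  have hex : ∃ c : ℕ, 0 < c ∧ ∃ w : Fin n →₀ ℕ, w i = 0 ∧ Finsupp.weight d w = c * d i :=
    ⟨d j, hd j, Finsupp.single j (d i), by simp [hij], by
      simp [Finsupp.weight_single, mul_comm]⟩
  obtain ⟨hpos, hw⟩ := Nat.find_spec hex
  refine ⟨Nat.find hex, hpos, hw, fun a ha hwa => Nat.find_min' hex ⟨ha, hwa⟩, ?_⟩
  intro u hu v hv
  set c := Nat.find hex
  have hus : u = Finsupp.single i (u i) := by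
    ext l
    by_cases h : l = i
    · simp [h]
    · have := hu.le l
      rw [Finsupp.single_eq_of_ne h] at this ⊢
      omega
  have huc : u i < c := by
    refine lt_of_le_of_ne (by simpa using hu.le i) fun h => hu.ne ?_
    rw [hus, h]
  have hwu : Finsupp.weight d u = u i * d i := by
    conv_lhs => rw [hus]
    simp [Finsupp.weight_single]
  -- Cancelling the common power of the `i`-th variable leaves a multiple `e * d i` with `e < c`,
  -- which minimality of `c` forces to be 0.
  have hsplit := Finsupp.single_add_erase i v
  have hws := congrArg (Finsupp.weight d) hsplit
  rw [map_add, Finsupp.weight_single, hv, hwu, smul_eq_mul] at hws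
  have hle : v i ≤ u i := Nat.le_of_mul_le_mul_right (by omega) (hd i)
  obtain ⟨e, he⟩ := Nat.exists_eq_add_of_le hle
  have hwe : Finsupp.weight d (v.erase i) = e * d i := by
    rw [he, add_mul] at hws
    omega
  rcases Nat.eq_zero_or_pos e with rfl | hepos
  · have := eq_zero_of_weight_eq_zero hd (v := v.erase i) (by simpa using hwe)
    rw [← hsplit, this, hus, he]
    simp
  · exact absurd ⟨hepos, v.erase i, by simp, hwe⟩ (Nat.find_min hex (m := e) (by omega))

end Semigroup

/-! ### Too many generators: `n ≥ 4`, or `n = 3` with `d 0` odd -/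

theorem IsGenArithmeticSeqWith.exists_eq {n h : ℕ} {d : Fin (n + 1) → ℕ}
    (hd : IsGenArithmeticSeqWith h d) :
    ∃ D, 0 < D ∧ ∀ i : Fin (n + 1), i ≠ 0 → d i = h * d 0 + i * D := by
  obtain ⟨-, D, hD, hs⟩ := hd
  refine ⟨D, hD, ?_⟩
  have main : ∀ (a : ℕ) (ha : a < n + 1),
      (if a = 0 then h * d ⟨a, ha⟩ else d ⟨a, ha⟩) = h * d 0 + a * D := by
    intro a
    induction a with
    | zero => intro _; simp
    | succ a ih =>
      intro ha
      have := hs ⟨a, by omega⟩ ⟨a + 1, ha⟩ rfl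
      simp only at this
      rw [this, ih (by omega)]
      ring
  intro i hi
  have := main i i.2
  rwa [if_neg (fun h => hi (Fin.ext h) : ¬(i : ℕ) = 0)] at this

section Bounds

variable {n h D : ℕ} {d : Fin (n + 1) → ℕ}

theorem injective_of_genArithmetic (hh : 0 < h) (hD : 0 < D)
    (hd : ∀ i : Fin (n + 1), i ≠ 0 → d i = h * d 0 + i * D) : Function.Injective d := by
  have hlt : ∀ i : Fin (n + 1), i ≠ 0 → d 0 < d i := by
    intro i hi
    rw [hd i hi]
    have h1 : 0 < (i : ℕ) * D := Nat.mul_pos (Nat.pos_of_ne_zero fun h => hi (Fin.ext h)) hD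
    have h2 : d 0 ≤ h * d 0 := Nat.le_mul_of_pos_left _ hh
    omega
  intro i j hij
  by_cases hi : i = 0
  · by_contra hne
    have := hlt j (by rintro rfl; exact hne hi)
    rw [hi] at hij
    omega
  · by_cases hj : j = 0
    · have := hlt i hi
      rw [hj] at hij
      omega
    · rw [hd i hi, hd j hj] at hij
      exact Fin.ext (Nat.eq_of_mul_eq_mul_right hD (by omega))

end Bounds

theorem le_spanFinrank_of_four_le (k : Type*) [Field k] {n h D : ℕ} {d : Fin (n + 4) → ℕ}
    (hh : 0 < h) (hD : 0 < D) (hpos : ∀ i, 0 < d i)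
    (hd : ∀ i : Fin (n + 4), i ≠ 0 → d i = h * d 0 + i * D)
    (hmin : MinimallyGeneratesSemigroup d) :
    n + 4 ≤ Submodule.spanFinrank (toricIdeal k d) := by
  have hinj := injective_of_genArithmetic hh hD hd
  obtain ⟨c, hc, ⟨w, hw0, hw⟩, -, hcmin⟩ :=
    exists_critical_multiple hpos (i := Fin.last (n + 3)) (j := 0) (by simp [Fin.ext_iff])
  have hsn : ∀ (i j : Fin (n + 4)) (a : ℕ), (j : ℕ) ≠ i → Finsupp.single i a j = 0 :=
    fun i j a hij => Finsupp.single_eq_of_ne fun h => hij (congrArg Fin.val h)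
  have hsz : ∀ (i : Fin (n + 4)) (a : ℕ), (i : ℕ) ≠ 0 → Finsupp.single i a 0 = 0 :=
    fun i a hi => hsn i 0 a hi.symm
  have hval : ∀ i : Fin (n + 4), (i : ℕ) ≠ 0 → d i = h * d 0 + i * D :=
    fun i hi => hd i fun h => hi (congrArg Fin.val h)
  obtain ⟨one, hone⟩ : ∃ i : Fin (n + 4), (i : ℕ) = 1 := ⟨⟨1, by omega⟩, rfl⟩
  obtain ⟨two, htwo⟩ : ∃ i : Fin (n + 4), (i : ℕ) = 2 := ⟨⟨2, by omega⟩, rfl⟩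
  obtain ⟨three, hthree⟩ : ∃ i : Fin (n + 4), (i : ℕ) = 3 := ⟨⟨3, by omega⟩, rfl⟩
  let m : Option (Option (Fin (n + 2))) → Fin (n + 4) →₀ ℕ
    | none => Finsupp.single (Fin.last _) c
    | some none => Finsupp.single two 1 + Finsupp.single two 1
    | some (some l) => Finsupp.single one 1 + Finsupp.single ⟨l + 1, by omega⟩ 1
  let w' : Option (Option (Fin (n + 2))) → Fin (n + 4) →₀ ℕ
    | none => w
    | some none => Finsupp.single one 1 + Finsupp.single three 1
    | some (some l) => Finsupp.single 0 h + Finsupp.single ⟨l + 2, by omega⟩ 1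
  -- The trailing monomials of rank 2 contain `x₀`, which no leading monomial does. The trailing
  -- `x₁x₃` may itself be a leading monomial of rank 2, hence its lower rank.
  let r : Option (Option (Fin (n + 2))) → ℕ
    | none => 0
    | some none => 1
    | some (some _) => 2
  have key := card_le_spanFinrank_toricIdeal (k := k) (d := d) m w' ?_ ?_ ?_ r ?_
  · simpa [add_assoc] using key
  · have h2 : ∀ l, m (some (some l)) ≠ m none := fun l hl => by
      have := DFunLike.congr_fun hl one
      simp only [m, Finsupp.add_apply, Finsupp.single_eq_same,
        hsn (Fin.last (n + 3)) one c (by simp [hone])] at this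
      omega
    have h3 : ∀ l, m (some (some l)) ≠ m (some none) := fun l hl => by
      have := DFunLike.congr_fun hl one
      simp only [m, Finsupp.add_apply, Finsupp.single_eq_same,
        hsn two one 1 (by omega)] at this
      omega
    have h4 : m (some none) ≠ m none := fun hl => by
      have := DFunLike.congr_fun hl two
      simp [m, Fin.ext_iff, htwo] at this
    rintro (_ | _ | l) (_ | _ | l') hll
    · rfl
    · exact absurd hll.symm h4
    · exact absurd hll.symm (h2 _)
    · exact absurd hll h4
    · rfl
    · exact absurd hll.symm (h3 _)
    · exact absurd hll (h2 _)
    · exact absurd hll (h3 _)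
    · have := Finsupp.single_left_injective one_ne_zero (add_left_cancel hll)
      simp only [Fin.mk.injEq, add_left_inj] at this
      rw [Fin.ext this]
  · rintro (_ | _ | l)
    · simp [m, w', hw, Finsupp.weight_single]
    · simp [m, w', Finsupp.weight_single, hval one (by omega), hval two (by omega),
        hval three (by omega), hone, htwo, hthree]
      ring
    · simp [m, w', Finsupp.weight_single, hval one (by omega), hval ⟨l + 1, _⟩ (by simp),
        hval ⟨l + 2, _⟩ (by simp), hone]
      ring
  · rintro (_ | _ | l) u hu v hv
    · exact hcmin u hu v hv
    · exact hmin.eq_of_lt_single_add_single hpos hinj hu hv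
    · exact hmin.eq_of_lt_single_add_single hpos hinj hu hv
  · have h0 : ∀ i, m i 0 = 0 := by
      rintro (_ | _ | l)
      · simp [m, hsz]
      · simp [m, hsz, htwo]
      · simp [m, hsz, hone]
    have hlast : ∀ i j, r i = 0 → r j ≤ 1 → w' j ≠ m i := by
      rintro (_ | _ | l) (_ | _ | l') hi hj heq
      · have := DFunLike.congr_fun heq (Fin.last (n + 3))
        simp [m, w', hw0] at this
        omega
      · have := DFunLike.congr_fun heq one
        simp [m, w', Fin.ext_iff, hone, hthree] at this
      all_goals simp [r] at hi hj
    rintro i (_ | _ | l) hij heq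
    · exact hlast i none (by simpa [r] using hij) zero_le_one heq
    · rcases i with (_ | _ | l)
      · exact hlast none (some none) rfl le_rfl heq
      · have := DFunLike.congr_fun heq one
        simp [m, w', Fin.ext_iff, hone, htwo, hthree] at this
      · simp [r] at hij
    · have := DFunLike.congr_fun heq 0
      rw [h0] at this
      simp [w', hsz] at this
      omega

theorem three_le_spanFinrank_of_odd (k : Type*) [Field k] {h D : ℕ} {d : Fin 3 → ℕ}
    (hh : 0 < h) (hD : 0 < D) (hpos : ∀ i, 0 < d i)
    (hd : ∀ i : Fin 3, i ≠ 0 → d i = h * d 0 + i * D)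
    (hmin : MinimallyGeneratesSemigroup d) (hcop : (d 0).Coprime D) (hodd : Odd (d 0)) :
    3 ≤ Submodule.spanFinrank (toricIdeal k d) := by
  have hinj := injective_of_genArithmetic hh hD hd
  have hd1 : d 1 = h * d 0 + D := by simpa using hd 1 (by decide)
  have hd2 : d 2 = h * d 0 + 2 * D := by simpa using hd 2 (by decide)
  obtain ⟨a, ha, ⟨u, hu0, hu⟩, -, hamin⟩ :=
    exists_critical_multiple hpos (i := (0 : Fin 3)) (j := 1) (by decide)
  obtain ⟨c, hc, ⟨w, hw0, hw⟩, hcle, hcmin⟩ :=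
    exists_critical_multiple hpos (i := (2 : Fin 3)) (j := 1) (by decide)
  have hd0 : d 0 ≠ 1 := by
    intro h1
    have := hmin.eq_single hpos hinj (u := Finsupp.single 0 (d 1)) (i := 1)
      (by simp [Finsupp.weight_single, h1])
    simpa [Finsupp.single_apply] using DFunLike.congr_fun this 1
  -- With `d 0 = 2q + 1`, the identity `(q + 1) d 2 = (qh + D) d 0 + d 1` bounds `c` by `q + 1`.
  -- Equality here would force `d 0 ∣ c`, which is too large. So the two critical binomials are not
  -- negatives of each other.
  have hne : a * d 0 ≠ c * d 2 := by
    intro heq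
    obtain ⟨q, hq⟩ := hodd
    have hcq : c ≤ q + 1 := by
      refine hcle (q + 1) (by omega) ⟨Finsupp.single 0 (q * h + D) + Finsupp.single 1 1, by simp, ?_⟩
      simp only [map_add, Finsupp.weight_single, hd1, hd2, hq, smul_eq_mul]
      ring
    have hcop2 : (d 0).Coprime (d 2) := by
      rw [hd2, Nat.coprime_mul_right_add_right]
      refine Nat.Coprime.mul_right ?_ hcop
      rw [Nat.coprime_two_right]
      exact ⟨q, hq⟩
    have hdvd : d 0 ∣ c := hcop2.dvd_of_dvd_mul_right (heq ▸ Dvd.intro_left a rfl)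
    have := Nat.le_of_dvd hc hdvd
    omega
  have key := card_le_spanFinrank_toricIdeal (k := k) (d := d)
    ![Finsupp.single 0 a, Finsupp.single 1 1 + Finsupp.single 1 1, Finsupp.single 2 c]
    ![u, Finsupp.single 0 h + Finsupp.single 2 1, w] ?_ ?_ ?_ ![0, 1, 0] ?_
  · simpa using key
  · have h01 : (Finsupp.single 0 a : Fin 3 →₀ ℕ) ≠ Finsupp.single 1 1 + Finsupp.single 1 1 :=
      fun h => by simpa [Finsupp.single_apply] using DFunLike.congr_fun h 1
    have h21 : (Finsupp.single 2 c : Fin 3 →₀ ℕ) ≠ Finsupp.single 1 1 + Finsupp.single 1 1 :=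
      fun h => by simpa [Finsupp.single_apply] using DFunLike.congr_fun h 1
    have h02 : (Finsupp.single 0 a : Fin 3 →₀ ℕ) ≠ Finsupp.single 2 c := fun h => by
      have := DFunLike.congr_fun h 0
      simp at this
      omega
    intro i j hij
    fin_cases i <;> fin_cases j
    · rfl
    · exact absurd hij h01
    · exact absurd hij h02
    · exact absurd hij.symm h01
    · rfl
    · exact absurd hij.symm h21
    · exact absurd hij.symm h02
    · exact absurd hij h21
    · rfl
  · intro i
    fin_cases i
    · simp [hu, Finsupp.weight_single]
    · simp [Finsupp.weight_single, hd1, hd2]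
      ring
    · simp [hw, Finsupp.weight_single]
  · intro i x hx v hv
    fin_cases i
    · exact hamin x hx v hv
    · exact hmin.eq_of_lt_single_add_single hpos hinj hx hv
    · exact hcmin x hx v hv
  · have hu' : ∀ b, u ≠ Finsupp.single 0 b := by
      rintro b rfl
      have : b = 0 := by simpa using hu0
      simp [this] at hu
      have := hpos 0
      omega
    have hw' : ∀ b, w ≠ Finsupp.single 2 b := by
      rintro b rfl
      have : b = 0 := by simpa using hw0
      simp [this] at hw
      have := hpos 2
      omega
    have huc : u ≠ Finsupp.single 2 c := by
      rintro rfl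
      simp [Finsupp.weight_single] at hu
      exact hne hu.symm
    have hwa : w ≠ Finsupp.single 0 a := by
      rintro rfl
      simp [Finsupp.weight_single] at hw
      exact hne hw
    intro i j hij
    fin_cases i <;> fin_cases j
    · exact hu' a
    · intro h
      simpa [Finsupp.single_apply] using DFunLike.congr_fun h 2
    · exact hwa
    · simp at hij
    · intro h
      simpa [Finsupp.single_apply] using DFunLike.congr_fun h 2
    · simp at hij
    · exact huc
    · intro h
      have := DFunLike.congr_fun h 0
      simp at this
      omega
    · exact hw' c

/-! ### The complete intersection case: `n = 3`, `d 0` even -/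

theorem pow_mul_pow_eq_of_coprime {M : Type*} [CommMonoid M] {x z : M} {a b : ℕ} (ha : 0 < a)
    (hab : a.Coprime b) (hxz : x ^ b = z ^ a) {A C A' C' : ℕ}
    (h : a * A + b * C = a * A' + b * C') : x ^ A * z ^ C = x ^ A' * z ^ C' := by
  wlog hC : C ≤ C' generalizing A C A' C'
  · exact (this h.symm (le_of_not_ge hC)).symm
  obtain ⟨e, rfl⟩ := Nat.exists_eq_add_of_le hC
  -- Two exponent pairs of equal weight differ by a multiple of `(b, -a)`, which is exactly the
  -- relation `xᵇ = zᵃ`.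
  have hae : a ∣ e := by
    refine hab.dvd_of_dvd_mul_left ((Nat.dvd_add_right (Dvd.intro A' rfl)).1 (?_ : a ∣ a * A' + b * e))
    exact ⟨A, by linarith⟩
  obtain ⟨t, rfl⟩ := hae
  have hA : A = A' + b * t := Nat.eq_of_mul_eq_mul_left ha (by linarith)
  rw [hA, pow_add, pow_mul, hxz, ← pow_mul, mul_assoc, ← pow_add, add_comm (a * t)]

/-- In a commutative monoid with `y² = xʰ z` and `xᵇ = zᵃ`, where `b = h a + D`, a monomial in
`x, y, z` only depends on its weight with respect to `(2a, 2ha + D, 2b)`. -/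
theorem pow_mul_pow_mul_pow_eq {M : Type*} [CommMonoid M] {x y z : M} {a h D : ℕ} (ha : 0 < a)
    (hD : Odd D) (hab : a.Coprime (h * a + D)) (hy : y ^ 2 = x ^ h * z)
    (hxz : x ^ (h * a + D) = z ^ a) {u₀ u₁ u₂ v₀ v₁ v₂ : ℕ}
    (hw : u₀ * (2 * a) + u₁ * (2 * (h * a) + D) + u₂ * (2 * (h * a + D)) =
      v₀ * (2 * a) + v₁ * (2 * (h * a) + D) + v₂ * (2 * (h * a + D))) :
    x ^ u₀ * y ^ u₁ * z ^ u₂ = x ^ v₀ * y ^ v₁ * z ^ v₂ := by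
  have hred : ∀ p q ε r : ℕ, x ^ p * y ^ (2 * q + ε) * z ^ r =
      y ^ ε * (x ^ (p + h * q) * z ^ (r + q)) := by
    intro p q ε r
    rw [pow_add y, pow_mul y, hy, mul_pow, ← pow_mul, pow_add x, pow_add z]
    simp only [mul_comm, mul_left_comm, mul_assoc]
  -- The weight of `y` is the only odd one, so the weight fixes the parity of its exponent; even
  -- powers of `y` are traded for `x` and `z` by `hred`.
  have hpar : u₁ % 2 = v₁ % 2 := by
    have h2 := congrArg (· % 2) hw
    obtain ⟨t, ht⟩ := hD
    have e : ∀ p q r : ℕ, (p * (2 * a) + q * (2 * (h * a) + D) + r * (2 * (h * a + D))) % 2 =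
        q % 2 := by
      intro p q r
      have : p * (2 * a) + q * (2 * (h * a) + D) + r * (2 * (h * a + D)) =
          q + 2 * (p * a + q * (h * a + t) + r * (h * a + D)) := by
        subst ht
        ring
      rw [this, Nat.add_mul_mod_self_left]
    simpa only [e] using h2
  obtain ⟨q, hq⟩ : ∃ q, q = u₁ / 2 := ⟨_, rfl⟩
  obtain ⟨q', hq'⟩ : ∃ q, q = v₁ / 2 := ⟨_, rfl⟩
  obtain ⟨ε, hε⟩ : ∃ ε, ε = u₁ % 2 := ⟨_, rfl⟩
  have hu : u₁ = 2 * q + ε := by omega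
  have hv : v₁ = 2 * q' + ε := by omega
  rw [hu, hv, hred, hred]
  congr 1
  refine pow_mul_pow_eq_of_coprime ha hab hxz ?_
  rw [hu, hv] at hw
  nlinarith [hw]

section EvenCase

variable {k : Type*} [Field k] {a h D : ℕ} {d : Fin 3 → ℕ}

theorem weight_fin_three (d : Fin 3 → ℕ) (u : Fin 3 →₀ ℕ) :
    Finsupp.weight d u = u 0 * d 0 + u 1 * d 1 + u 2 * d 2 := by
  rw [Finsupp.weight_eq_sum, Fin.sum_univ_three]
  simp only [smul_eq_mul]

theorem monomial_fin_three (u : Fin 3 →₀ ℕ) :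
    monomial u (1 : k) = X 0 ^ u 0 * X 1 ^ u 1 * X 2 ^ u 2 := by
  rw [monomial_eq, Finsupp.prod_fintype _ _ (by simp), Fin.prod_univ_three, C_1, one_mul]

theorem toricIdeal_eq_span (ha : 0 < a) (hD : Odd D) (hab : a.Coprime (h * a + D))
    (hd0 : d 0 = 2 * a) (hd1 : d 1 = 2 * (h * a) + D) (hd2 : d 2 = 2 * (h * a + D)) :
    Ideal.span {X 1 ^ 2 - X 0 ^ h * X 2, X 0 ^ (h * a + D) - X 2 ^ a} = toricIdeal k d := by
  refine le_antisymm ?_ (toricIdeal_le fun u v huv => ?_)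
  · rw [Ideal.span_le]
    rintro _ (rfl | rfl)
    · rw [SetLike.mem_coe, toricIdeal, RingHom.mem_ker]
      simp only [map_sub, map_mul, map_pow, aeval_X, hd0, hd1, hd2]
      ring
    · rw [SetLike.mem_coe, toricIdeal, RingHom.mem_ker]
      simp only [map_sub, map_pow, aeval_X, hd0, hd2]
      ring
  · rw [weight_fin_three, weight_fin_three, hd0, hd1, hd2] at huv
    set J : Ideal (MvPolynomial (Fin 3) k) :=
      Ideal.span {X 1 ^ 2 - X 0 ^ h * X 2, X 0 ^ (h * a + D) - X 2 ^ a}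
    rw [← Ideal.Quotient.mk_eq_mk_iff_sub_mem, monomial_fin_three, monomial_fin_three]
    simp only [map_mul, map_pow]
    refine pow_mul_pow_mul_pow_eq ha hD hab ?_ ?_ huv
    · rw [← map_pow, ← map_pow, ← map_mul, Ideal.Quotient.mk_eq_mk_iff_sub_mem]
      exact Ideal.subset_span (Or.inl rfl)
    · rw [← map_pow, ← map_pow, Ideal.Quotient.mk_eq_mk_iff_sub_mem]
      exact Ideal.subset_span (Or.inr rfl)

/-- The curve lies on the surface parametrized by `ψ`, whose ideal `P` gives the chain of primes `0
< P < I`. -/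
theorem two_le_height_toricIdeal (ha : 0 < a)
    (hd0 : d 0 = 2 * a) (hd1 : d 1 = 2 * (h * a) + D) (hd2 : d 2 = 2 * (h * a + D)) :
    2 ≤ (toricIdeal k d).height := by
  let ψ : MvPolynomial (Fin 3) k →ₐ[k] MvPolynomial (Fin 2) k :=
    aeval ![X 0, X 0 ^ h * X 1, X 0 ^ h * X 1 ^ 2]
  let θ : MvPolynomial (Fin 2) k →ₐ[k] Polynomial k :=
    aeval ![Polynomial.X ^ (2 * a), Polynomial.X ^ D]
  let φ : MvPolynomial (Fin 3) k →ₐ[k] Polynomial k :=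
    aeval fun i => (Polynomial.X : Polynomial k) ^ d i
  have hcomp : θ.comp ψ = φ := by
    refine algHom_ext fun i => ?_
    fin_cases i
    · simp [ψ, θ, φ, hd0]
    · simp [ψ, θ, φ, hd1]
      ring
    · simp [ψ, θ, φ, hd2]
      ring
  let P : Ideal (MvPolynomial (Fin 3) k) := RingHom.ker ψ
  have hP : P.IsPrime := RingHom.ker_isPrime _
  have hbot : (⊥ : Ideal (MvPolynomial (Fin 3) k)) < P := by
    rw [bot_lt_iff_ne_bot]
    intro hP0
    have hmem : (X 1 ^ 2 - X 0 ^ h * X 2 : MvPolynomial (Fin 3) k) ∈ P := by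
      rw [RingHom.mem_ker]
      simp [ψ]
      ring
    rw [hP0, Ideal.mem_bot] at hmem
    have := congrArg (aeval ![(0 : k), 1, 0]) hmem
    simp at this
  have hlt : P < toricIdeal k d := by
    refine lt_of_le_of_ne ?_ ?_
    · intro f hf
      rw [RingHom.mem_ker] at hf
      rw [toricIdeal, RingHom.mem_ker]
      change φ f = 0
      rw [← hcomp, AlgHom.comp_apply, hf, map_zero]
    · intro heq
      have hmem : (X 0 ^ (h * a + D) - X 2 ^ a : MvPolynomial (Fin 3) k) ∈ P := by
        rw [heq, toricIdeal, RingHom.mem_ker]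
        simp only [map_sub, map_pow, aeval_X, hd0, hd2]
        ring
      rw [RingHom.mem_ker] at hmem
      have := congrArg (aeval ![(1 : k), 0]) hmem
      simp [ψ, ha.ne'] at this
  have h1 := Ideal.height_strict_mono_of_isPrime_of_isPrime hbot
  have h2 := Ideal.height_strict_mono_of_isPrime_of_isPrime hlt
  calc (2 : ℕ∞) = 0 + 1 + 1 := by norm_num
    _ ≤ P.height + 1 := by
      gcongr
      rw [Ideal.height_bot] at h1
      simpa using Order.add_one_le_of_lt h1
    _ ≤ _ := Order.add_one_le_of_lt h2

/-- Even elements of the semigroup form `2⟨a, b⟩` and odd ones `d 1 + 2⟨a, b⟩`, so the last gap is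
the last odd one. -/
theorem frobeniusNumber_of_even (ha : 1 < a) (hb : 1 < h * a + D) (hD : Odd D)
    (hab : a.Coprime (h * a + D))
    (hd0 : d 0 = 2 * a) (hd1 : d 1 = 2 * (h * a) + D) (hd2 : d 2 = 2 * (h * a + D)) :
    FrobeniusNumber (2 * (a * (h * a + D) - a - (h * a + D)) + d 1) (Set.range d) := by
  have hF := frobeniusNumber_iff.1 (frobeniusNumber_pair hab ha hb)
  set b := h * a + D with hbdef
  set F := a * b - a - b
  obtain ⟨hF1, hF2⟩ := hF
  simp only [AddSubmonoid.mem_closure_pair, smul_eq_mul] at hF1 hF2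
  have hmem : ∀ s, s ∈ AddSubmonoid.closure (Set.range d) ↔
      ∃ x y z, x * d 0 + y * d 1 + z * d 2 = s := by
    intro s
    rw [mem_closure_range_iff_exists_weight]
    constructor
    · rintro ⟨u, rfl⟩
      exact ⟨u 0, u 1, u 2, (weight_fin_three d u).symm⟩
    · rintro ⟨x, y, z, rfl⟩
      refine ⟨Finsupp.equivFunOnFinite.symm ![x, y, z], ?_⟩
      rw [weight_fin_three]
      rfl
  obtain ⟨t, ht⟩ := hD
  rw [frobeniusNumber_iff]
  constructor
  · rw [hmem]
    rintro ⟨x, y, z, hxyz⟩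
    rcases Nat.even_or_odd' y with ⟨q, rfl | rfl⟩
    · have h2 := congrArg (· % 2) hxyz
      rw [hd0, hd1, hd2, ht, show x * (2 * a) + 2 * q * (2 * (h * a) + (2 * t + 1)) + z * (2 * b) =
        2 * (x * a + q * (2 * (h * a) + (2 * t + 1)) + z * b) by ring] at h2
      omega
    -- Replacing each `2 d 1` by `h d 0 + d 2` would put `F` in `⟨a, b⟩`.
    · refine hF1 ⟨x + q * h, z + q, ?_⟩
      rw [hd0, hd1, hd2] at hxyz
      have : 2 * ((x + q * h) * a + (z + q) * b) = 2 * F := by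
        rw [hbdef] at hxyz ⊢
        linarith
      omega
  · intro s hs
    rw [hmem]
    rcases Nat.even_or_odd' s with ⟨q, rfl | rfl⟩
    · obtain ⟨x, z, hxz⟩ := hF2 q (by omega)
      refine ⟨x, 0, z, ?_⟩
      rw [hd0, hd2, ← hxz]
      ring
    · obtain ⟨x, z, hxz⟩ := hF2 (q - (h * a + t)) (by omega)
      refine ⟨x, 1, z, ?_⟩
      have : q = (x * a + z * b) + (h * a + t) := by omega
      rw [hd0, hd1, hd2, this, ht]
      ring

end EvenCase

/-! ### Arithmetic of the parameters and assembly -/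

theorem coprime_of_gcd_eq_one {h D : ℕ} {d : Fin 3 → ℕ} (hgcd : Finset.univ.gcd d = 1)
    (hd1 : d 1 = h * d 0 + D) (hd2 : d 2 = h * d 0 + 2 * D) : (d 0).Coprime D := by
  have hdvd : (d 0).gcd D ∣ Finset.univ.gcd d := by
    have h0 := Nat.gcd_dvd_left (d 0) D
    have hD := Nat.gcd_dvd_right (d 0) D
    refine Finset.dvd_gcd fun i _ => ?_
    fin_cases i
    · exact h0
    · simpa [hd1] using dvd_add (h0.mul_left h) hD
    · simpa [hd2] using dvd_add (h0.mul_left h) (hD.mul_left 2)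
  rw [hgcd] at hdvd
  exact Nat.dvd_one.1 hdvd

theorem even_case_parameters {h : ℕ} {d : Fin 3 → ℕ} (hpos : ∀ i, 0 < d i)
    (hgcd : Finset.univ.gcd d = 1) (hmin : MinimallyGeneratesSemigroup d)
    (hh : IsGenArithmeticSeqWith h d) (heven : Even (d 0)) :
    ∃ a D : ℕ, 1 < a ∧ 1 < h * a + D ∧ Odd D ∧ a.Coprime (h * a + D) ∧ d 0 = 2 * a ∧
      d 1 = 2 * (h * a) + D ∧ d 2 = 2 * (h * a + D) := by
  obtain ⟨D, hD, hd⟩ := hh.exists_eq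
  have hinj := injective_of_genArithmetic hh.1 hD hd
  have hd1 : d 1 = h * d 0 + D := by simpa using hd 1 (by decide)
  have hd2 : d 2 = h * d 0 + 2 * D := by simpa using hd 2 (by decide)
  have hcop := coprime_of_gcd_eq_one hgcd hd1 hd2
  obtain ⟨a, ha⟩ := heven.two_dvd
  rw [ha] at hd1 hd2 hcop
  have hd1' : d 1 = 2 * (h * a) + D := by rw [hd1]; ring
  have hd2' : d 2 = 2 * (h * a + D) := by rw [hd2]; ring
  have hapos : 0 < a := by
    have := hpos 0
    omega
  -- If `d 0 = 2`, the even number `d 2` would be redundant.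
  have hne : a ≠ 1 := by
    rintro rfl
    have := hmin.eq_single hpos hinj (u := Finsupp.single 0 (h * 1 + D)) (i := 2)
      (by rw [hd2', Finsupp.weight_single, ha, smul_eq_mul]; ring)
    simpa using DFunLike.congr_fun this 2
  have hha : 0 < h * a := Nat.mul_pos hh.1 hapos
  refine ⟨a, D, by omega, by omega, ?_, ?_, ha, hd1', hd2'⟩
  · exact Nat.coprime_two_left.1 hcop.coprime_mul_right
  · rw [Nat.coprime_mul_right_add_right]
    exact hcop.coprime_mul_left

theorem isCompleteIntersectionIdeal_of_even (k : Type*) [Field k] {h : ℕ} {d : Fin 3 → ℕ}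
    (hpos : ∀ i, 0 < d i) (hgcd : Finset.univ.gcd d = 1) (hmin : MinimallyGeneratesSemigroup d)
    (hh : IsGenArithmeticSeqWith h d) (heven : Even (d 0)) :
    IsCompleteIntersectionIdeal (toricIdeal k d) := by
  obtain ⟨a, D, ha, -, hD, hab, hd0, hd1, hd2⟩ := even_case_parameters hpos hgcd hmin hh heven
  refine ⟨toricIdeal_fg, le_antisymm ?_ (Ideal.height_le_spanFinrank _ toricIdeal_isPrime.ne_top)⟩
  refine le_trans ?_ (two_le_height_toricIdeal (by omega) hd0 hd1 hd2)
  rw [← toricIdeal_eq_span (by omega) hD hab hd0 hd1 hd2]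
  exact (Submodule.spanFinrank_span_le_encard _).trans ((Set.encard_insert_le _ _).trans_eq
    (by rw [Set.encard_singleton]; norm_num))

/-- A proper subset has at most one element, but by Krull's height theorem an ideal of height at
least 2 needs two generators. -/
theorem minimal_span_eq_toricIdeal (k : Type*) [Field k] {h : ℕ} {d : Fin 3 → ℕ}
    (hpos : ∀ i, 0 < d i) (hgcd : Finset.univ.gcd d = 1) (hmin : MinimallyGeneratesSemigroup d)
    (hh : IsGenArithmeticSeqWith h d) (heven : Even (d 0)) :
    Minimal (fun G : Set (MvPolynomial (Fin 3) k) => Ideal.span G = toricIdeal k d)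
      {X 1 ^ 2 - X 0 ^ h * X 2, X 0 ^ (d 2 / 2) - X 2 ^ (d 0 / 2)} := by
  obtain ⟨a, D, ha, -, hD, hab, hd0, hd1, hd2⟩ := even_case_parameters hpos hgcd hmin hh heven
  rw [show d 2 / 2 = h * a + D by omega, show d 0 / 2 = a by omega]
  refine ⟨toricIdeal_eq_span (by omega) hD hab hd0 hd1 hd2, fun T hT hTS => ?_⟩
  by_contra hne
  have hfin : ({X 1 ^ 2 - X 0 ^ h * X 2, X 0 ^ (h * a + D) - X 2 ^ a} :
      Set (MvPolynomial (Fin 3) k)).Finite := Set.toFinite _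
  have h1 := Set.ncard_lt_ncard (ssubset_of_subset_not_subset hTS hne) hfin
  have h2 := h1.trans_le (Set.ncard_insert_le _ _)
  rw [Set.ncard_singleton] at h2
  have h3 := Submodule.spanFinrank_span_le_ncard_of_finite (R := MvPolynomial (Fin 3) k)
    (hfin.subset hTS)
  have h4 := (two_le_height_toricIdeal (k := k) (by omega) hd0 hd1 hd2).trans
    (Ideal.height_le_spanFinrank _ toricIdeal_isPrime.ne_top)
  rw [← hT] at h4
  have h5 : 2 ≤ (Ideal.span T).spanFinrank := by exact_mod_cast h4
  have h6 : (Ideal.span T).spanFinrank ≤ T.ncard := h3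
  omega

theorem eq_three_and_even_of_isCompleteIntersectionIdeal (k : Type*) [Field k] {n : ℕ}
    {d : Fin (n + 3) → ℕ} (hd : IsGenArithmeticSeq d) (hgcd : Finset.univ.gcd d = 1)
    (hmin : MinimallyGeneratesSemigroup d) (hci : IsCompleteIntersectionIdeal (toricIdeal k d)) :
    n = 0 ∧ Even (d 0) := by
  obtain ⟨hpos, h, hh⟩ := hd
  obtain ⟨D, hD, hdD⟩ := hh.exists_eq
  have hlt := height_toricIdeal_lt (k := k) (by omega) hpos
  rw [← hci.2, Nat.cast_lt] at hlt
  rcases n with _ | n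
  · refine ⟨rfl, ?_⟩
    by_contra hodd
    have hcop : (d 0).Coprime D := coprime_of_gcd_eq_one (h := h) hgcd
      (by simpa using hdD 1 (by decide)) (by simpa using hdD 2 (by decide))
    have := three_le_spanFinrank_of_odd k hh.1 hD hpos hdD hmin hcop (Nat.not_even_iff_odd.1 hodd)
    omega
  · have := le_spanFinrank_of_four_le k hh.1 hD hpos hdD hmin
    omega

theorem mainTheorem1 (k : Type*) [Field k] (n : ℕ) (hn : 3 ≤ n) (d : Fin n → ℕ)
    (hd : IsGenArithmeticSeq d) (hgcd : Finset.univ.gcd d = 1)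
    (hmin : MinimallyGeneratesSemigroup d) :
    (IsCompleteIntersectionIdeal (toricIdeal k d) ↔ n = 3 ∧ Even (d ⟨0, by omega⟩)) ∧
    (IsCompleteIntersectionIdeal (toricIdeal k d) →
      Even (d ⟨2, by omega⟩) ∧
      (∀ h : ℕ, IsGenArithmeticSeqWith h d →
        (h : ℚ) = (2 * (d ⟨1, by omega⟩ : ℚ) - d ⟨2, by omega⟩) / d ⟨0, by omega⟩ ∧
        Minimal (fun G : Set (MvPolynomial (Fin n) k) => Ideal.span G = toricIdeal k d)
          {MvPolynomial.X ⟨1, by omega⟩ ^ 2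
              - MvPolynomial.X ⟨0, by omega⟩ ^ h * MvPolynomial.X ⟨2, by omega⟩,
            MvPolynomial.X ⟨0, by omega⟩ ^ (d ⟨2, by omega⟩ / 2)
              - MvPolynomial.X ⟨2, by omega⟩ ^ (d ⟨0, by omega⟩ / 2)}) ∧
      ∃ g : ℕ, FrobeniusNumber g (Set.range d) ∧
        (g : ℚ) = (d ⟨0, by omega⟩ : ℚ) * d ⟨2, by omega⟩ / 2 - d ⟨0, by omega⟩
          + d ⟨1, by omega⟩ - d ⟨2, by omega⟩) := by
  obtain ⟨n, rfl⟩ := Nat.exists_eq_add_of_le' hn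
  have hnec := eq_three_and_even_of_isCompleteIntersectionIdeal k hd hgcd hmin
  obtain ⟨hpos, h₀, hh₀⟩ := hd
  refine ⟨⟨fun hci => ⟨by have := (hnec hci).1; omega, (hnec hci).2⟩, ?_⟩, fun hci => ?_⟩
  · rintro ⟨hn3, heven⟩
    obtain rfl : n = 0 := by omega
    exact isCompleteIntersectionIdeal_of_even k hpos hgcd hmin hh₀ heven
  · obtain ⟨rfl, heven⟩ := hnec hci
    change Even (d 2) ∧ (∀ h : ℕ, IsGenArithmeticSeqWith h d →
        (h : ℚ) = (2 * (d 1 : ℚ) - d 2) / d 0 ∧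
        Minimal (fun G : Set (MvPolynomial (Fin 3) k) => Ideal.span G = toricIdeal k d)
          {X 1 ^ 2 - X 0 ^ h * X 2, X 0 ^ (d 2 / 2) - X 2 ^ (d 0 / 2)}) ∧
      ∃ g : ℕ, FrobeniusNumber g (Set.range d) ∧ (g : ℚ) = (d 0 : ℚ) * d 2 / 2 - d 0 + d 1 - d 2
    refine ⟨?_, fun h hh => ⟨?_, minimal_span_eq_toricIdeal k hpos hgcd hmin hh heven⟩, ?_⟩
    · obtain ⟨a, D, -, -, -, -, -, -, hd2⟩ := even_case_parameters hpos hgcd hmin hh₀ heven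
      exact hd2 ▸ even_two_mul _
    · obtain ⟨a, D, ha, -, -, -, hd0, hd1, hd2⟩ := even_case_parameters hpos hgcd hmin hh heven
      have ha0 : (a : ℚ) ≠ 0 := by exact_mod_cast (by omega : a ≠ 0)
      rw [hd0, hd1, hd2]
      push_cast
      field_simp
      ring
    · obtain ⟨a, D, ha, hb, hD, hab, hd0, hd1, hd2⟩ :=
        even_case_parameters hpos hgcd hmin hh₀ heven
      refine ⟨_, frobeniusNumber_of_even ha hb hD hab hd0 hd1 hd2, ?_⟩
      -- Since `a, b > 1`, the truncated subtraction `ab - a - b` is a genuine one and may be cast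
      -- to `ℚ`.
      have hle : a + (h₀ * a + D) ≤ a * (h₀ * a + D) := Nat.add_le_mul ha hb
      rw [Nat.sub_sub]
      push_cast [Nat.cast_sub hle]
      rw [hd0, hd1, hd2]
      push_cast
      ring
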